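/- Let $E$ and $F$ be (real) Banach lattices with norm duals $E'$, $F'$, where $F'$ carries the dual order ($f\le g$ iff $f(x)\le g(x)$ for all $x\in F^+$), under which it is again a Banach lattice. Let $T:E\to F$ be a bounded linear operator with adjoint $T':F'\to E'$, $T'f=f\circ T$, and let $\mathcal S\subset F'$ be norm bounded, with solid hull $\mathrm{sol}(\mathcal S)=\{f\in F' : |f|\le |h| \text{ for some } h\in\mathcal S\}$. A net $(f_\alpha)$ in $F'$ is called uaw-null if $|f_\alpha|\wedge g\to 0$ weakly (for $\sigma(F',F'')$) for every $g\in (F')^+$, and uaw$^*$-null if $|f_\alpha|\wedge g\to 0$ weak$^*$ (for $\sigma(F',F)$) for every $g\in (F')^+$. The operator $T'$ is called $\mathcal S$-L-weakly compact if $\|T'f_n\|\to 0$ for every uaw-null sequence $(f_n)\subset \mathrm{sol}(\mathcal S)$. Then the following statements are equivalent: 1. $T'$ is $\mathcal S$-L-weakly compact. 2. For each $\varepsilon>0$ there exist $g\in (F')^+$ and $u\in F^+$ such that $\|T'f\|\le (|f|\wedge g)(u)+\varepsilon$ for all $f\in \mathrm{sol}(\mathcal S)$. 3. For every uaw$^*$-null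 net $(f_\alpha)\subset \mathrm{sol}(\mathcal S)$, $\|T'f_\alpha\|\to 0$. 4. For every uaw$^*$-null sequence $(f_n)\subset \mathrm{sol}(\mathcal S)$, $\|T'f_n\|\to 0$. -/

import Mathlib

open Filter Topology

universe u v w

set_option linter.unusedSectionVars false

/-! ### The norm dual of a Banach lattice as a Banach lattice

For a Banach lattice `F` the dual `F'` is `StrongDual ℝ F`, ordered by `f ≤ g` iff `f x ≤ g x` for
all `x ≥ 0`. Positive parts are given by the Riesz-Kantorovich formula
`f⁺ x = sup {f y | 0 ≤ y ≤ x}` for `x ≥ 0`. -/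

namespace DualLattice

section

variable {F : Type*} [NormedAddCommGroup F] [Lattice F] [HasSolidNorm F] [IsOrderedAddMonoid F]
  [NormedSpace ℝ F]

/-- The value `sup {f y | 0 ≤ y ≤ x}` of the positive part of `f` at `x ≥ 0`. -/
noncomputable def coneSup (f : StrongDual ℝ F) (x : F) : ℝ := sSup (f '' Set.Icc 0 x)

theorem norm_le_of_mem_Icc {x y : F} (hy : y ∈ Set.Icc 0 x) : ‖y‖ ≤ ‖x‖ :=
  HasSolidNorm.solid (by rw [abs_of_nonneg hy.1, abs_of_nonneg (hy.1.trans hy.2)]; exact hy.2)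

theorem apply_le_of_mem_Icc (f : StrongDual ℝ F) {x y : F} (hy : y ∈ Set.Icc 0 x) :
    f y ≤ ‖f‖ * ‖x‖ :=
  (le_abs_self _).trans ((f.le_opNorm y).trans
    (mul_le_mul_of_nonneg_left (norm_le_of_mem_Icc hy) (norm_nonneg f)))

theorem le_coneSup (f : StrongDual ℝ F) {x y : F} (hy : y ∈ Set.Icc 0 x) : f y ≤ coneSup f x :=
  le_csSup ⟨‖f‖ * ‖x‖, by rintro _ ⟨z, hz, rfl⟩; exact apply_le_of_mem_Icc f hz⟩ ⟨y, hy, rfl⟩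

theorem coneSup_le (f : StrongDual ℝ F) {x : F} (hx : 0 ≤ x) {c : ℝ}
    (h : ∀ y ∈ Set.Icc 0 x, f y ≤ c) : coneSup f x ≤ c :=
  csSup_le ⟨f 0, 0, ⟨le_rfl, hx⟩, rfl⟩ (by rintro _ ⟨z, hz, rfl⟩; exact h z hz)

theorem coneSup_nonneg (f : StrongDual ℝ F) {x : F} (hx : 0 ≤ x) : 0 ≤ coneSup f x := by
  simpa using le_coneSup f (y := 0) ⟨le_rfl, hx⟩

theorem coneSup_add (f : StrongDual ℝ F) {a b : F} (ha : 0 ≤ a) (hb : 0 ≤ b) :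
    coneSup f (a + b) = coneSup f a + coneSup f b := by
  apply le_antisymm
  · refine coneSup_le f (add_nonneg ha hb) fun y hy => ?_
    have h1 : y ⊓ a ∈ Set.Icc 0 a := ⟨le_inf hy.1 ha, inf_le_right⟩
    have h2 : y - y ⊓ a ∈ Set.Icc 0 b := by
      refine ⟨sub_nonneg.2 inf_le_left, ?_⟩
      rw [sub_le_comm]
      exact le_inf (sub_le_self _ hb) (sub_le_iff_le_add.2 hy.2)
    have h3 : f y = f (y ⊓ a) + f (y - y ⊓ a) := by rw [← map_add]; congr 1; abel
    rw [h3]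
    exact add_le_add (le_coneSup f h1) (le_coneSup f h2)
  · rw [← le_sub_iff_add_le]
    refine coneSup_le f ha fun y hy => ?_
    rw [le_sub_comm]
    refine coneSup_le f hb fun z hz => ?_
    rw [le_sub_iff_add_le, add_comm, ← map_add]
    exact le_coneSup f ⟨add_nonneg hy.1 hz.1, add_le_add hy.2 hz.2⟩

theorem coneSup_sub (f : StrongDual ℝ F) {x a b : F} (ha : 0 ≤ a) (hb : 0 ≤ b) (h : x = a - b) :
    coneSup f x⁺ - coneSup f x⁻ = coneSup f a - coneSup f b := by
  have h1 : x⁺ + b = a + x⁻ := by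
    have := posPart_sub_negPart x
    rw [← sub_eq_sub_iff_add_eq_add, this, h]
  have h2 := congrArg (coneSup f) h1
  rw [coneSup_add f (posPart_nonneg x) hb, coneSup_add f ha (negPart_nonneg x)] at h2
  linarith

/-- The positive part `f⁺` of a functional `f`, extended from the positive cone by
`f⁺ x = f⁺ (x⁺) - f⁺ (x⁻)`. -/
noncomputable def dualPosPart (f : StrongDual ℝ F) : StrongDual ℝ F :=
  AddMonoidHom.toRealLinearMap
    { toFun := fun x => coneSup f x⁺ - coneSup f x⁻
      map_zero' := by simp
      map_add' := fun x y => by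
        rw [coneSup_sub f (a := x⁺ + y⁺) (b := x⁻ + y⁻)
          (add_nonneg (posPart_nonneg x) (posPart_nonneg y))
          (add_nonneg (negPart_nonneg x) (negPart_nonneg y))
          (by conv_lhs => rw [← posPart_sub_negPart x, ← posPart_sub_negPart y]
              abel),
          coneSup_add f (posPart_nonneg x) (posPart_nonneg y),
          coneSup_add f (negPart_nonneg x) (negPart_nonneg y)]
        ring }
    (by
      refine AddMonoidHomClass.continuous_of_bound _ ‖f‖ fun x => ?_
      have key : ∀ z : F, 0 ≤ z → z ≤ |x| → coneSup f z ≤ ‖f‖ * ‖x‖ := fun z hz hzx =>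
        coneSup_le f hz fun y hy => by
          have := apply_le_of_mem_Icc f (x := |x|) ⟨hy.1, hy.2.trans hzx⟩
          rwa [norm_abs_eq_norm] at this
      have h1 := key x⁺ (posPart_nonneg x) (sup_le (le_abs_self x) (abs_nonneg x))
      have h2 := key x⁻ (negPart_nonneg x) (sup_le (neg_le_abs x) (abs_nonneg x))
      have h3 := coneSup_nonneg f (posPart_nonneg x)
      have h4 := coneSup_nonneg f (negPart_nonneg x)
      simp only [AddMonoidHom.coe_mk, ZeroHom.coe_mk, Real.norm_eq_abs]
      exact abs_sub_le_iff.2 ⟨by linarith, by linarith⟩)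

theorem dualPosPart_apply (f : StrongDual ℝ F) {x : F} (hx : 0 ≤ x) :
    dualPosPart f x = coneSup f x := by
  change coneSup f x⁺ - coneSup f x⁻ = _
  rw [coneSup_sub f hx le_rfl (sub_zero x).symm]
  have : coneSup f 0 = 0 :=
    le_antisymm (coneSup_le f le_rfl fun y hy => by
      rw [le_antisymm hy.2 hy.1, map_zero]) (coneSup_nonneg f le_rfl)
  rw [this, sub_zero]

/-- The order of the dual: `f ≤ g` iff `f x ≤ g x` for all `x ≥ 0`. -/
noncomputable instance instPartialOrder : PartialOrder (StrongDual ℝ F) where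
  le f g := ∀ x : F, 0 ≤ x → f x ≤ g x
  le_refl f x _ := le_rfl
  le_trans f g h hfg hgh x hx := (hfg x hx).trans (hgh x hx)
  le_antisymm f g hfg hgf := by
    ext x
    rw [← posPart_sub_negPart x, map_sub, map_sub,
      le_antisymm (hfg _ (posPart_nonneg x)) (hgf _ (posPart_nonneg x)),
      le_antisymm (hfg _ (negPart_nonneg x)) (hgf _ (negPart_nonneg x))]

theorem le_def {f g : StrongDual ℝ F} : f ≤ g ↔ ∀ x : F, 0 ≤ x → f x ≤ g x := Iff.rfl

instance instIsOrderedAddMonoid : IsOrderedAddMonoid (StrongDual ℝ F) where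
  add_le_add_left f g h k x hx := by
    simpa using h x hx

theorem le_dualPosPart (f : StrongDual ℝ F) : f ≤ dualPosPart f := fun x hx => by
  rw [dualPosPart_apply f hx]
  exact le_coneSup f ⟨hx, le_rfl⟩

theorem dualPosPart_nonneg (f : StrongDual ℝ F) : 0 ≤ dualPosPart f := fun x hx => by
  rw [dualPosPart_apply f hx]
  exact coneSup_nonneg f hx

theorem dualPosPart_le {f g : StrongDual ℝ F} (h : f ≤ g) (hg : 0 ≤ g) : dualPosPart f ≤ g :=
  fun x hx => by
    rw [dualPosPart_apply f hx]
    refine coneSup_le f hx fun y hy => (h y hy.1).trans ?_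
    have := hg (x - y) (sub_nonneg.2 hy.2)
    rw [map_sub] at this
    simpa using this

/-- The lattice operations of the dual: `f ⊔ g = g + (f - g)⁺` and `f ⊓ g = f - (f - g)⁺`. -/
noncomputable instance instLattice : Lattice (StrongDual ℝ F) where
  sup f g := g + dualPosPart (f - g)
  le_sup_left f g := by
    have := le_dualPosPart (f - g)
    rwa [sub_le_iff_le_add'] at this
  le_sup_right f g := le_add_of_nonneg_right (dualPosPart_nonneg _)
  sup_le f g h hf hg := by
    rw [← le_sub_iff_add_le']
    exact dualPosPart_le (sub_le_sub_right hf g) (sub_nonneg.2 hg)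
  inf f g := f - dualPosPart (f - g)
  inf_le_left f g := sub_le_self _ (dualPosPart_nonneg _)
  inf_le_right f g := by
    rw [sub_le_comm]
    exact le_dualPosPart _
  le_inf h f g hf hg := by
    rw [le_sub_comm]
    exact dualPosPart_le (sub_le_sub_left hg f) (sub_nonneg.2 hf)

theorem abs_apply_le (f : StrongDual ℝ F) (x : F) : |f x| ≤ |f| |x| := by
  have h : ∀ y : F, 0 ≤ y → |f y| ≤ |f| y := fun y hy =>
    abs_le'.2 ⟨le_abs_self f y hy, neg_le_abs f y hy⟩
  have h1 := h _ (posPart_nonneg x)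
  have h2 := h _ (negPart_nonneg x)
  rw [← posPart_add_negPart x, map_add]
  conv_lhs => rw [← posPart_sub_negPart x, map_sub]
  exact (abs_sub _ _).trans (add_le_add h1 h2)

theorem abs_apply_abs_le (f : StrongDual ℝ F) (x : F) : |f| |x| ≤ ‖f‖ * ‖x‖ := by
  have h0 : |f| = dualPosPart (f - -f) - f := by
    change -f + dualPosPart (f - -f) = _
    abel
  rw [h0, _root_.sub_apply, dualPosPart_apply _ (abs_nonneg x), sub_le_iff_le_add]
  refine coneSup_le _ (abs_nonneg x) fun y hy => ?_
  have h1 : |(y + y - |x| : F)| ≤ |x| := by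
    refine abs_le'.2 ⟨?_, ?_⟩
    · rw [sub_le_iff_le_add]; exact add_le_add hy.2 hy.2
    · rw [neg_sub]; exact sub_le_self _ (add_nonneg hy.1 hy.1)
  have h2 : f (y + y - |x|) ≤ ‖f‖ * ‖x‖ :=
    (le_abs_self _).trans ((f.le_opNorm _).trans
      (mul_le_mul_of_nonneg_left (HasSolidNorm.solid h1) (norm_nonneg f)))
  rw [map_sub, map_add] at h2
  simp only [_root_.sub_apply, _root_.neg_apply]
  linarith

instance instHasSolidNorm : HasSolidNorm (StrongDual ℝ F) where
  solid f g h := f.opNorm_le_bound (norm_nonneg g) fun x =>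
    (abs_apply_le f x).trans ((h |x| (abs_nonneg x)).trans (abs_apply_abs_le g x))

end

end DualLattice

/-! ### Unbounded absolute weak and weak* convergence -/

/-- `x` is uaw-convergent to `a` along `l`: `|x i - a| ⊓ z → 0` weakly, for every `z ≥ 0`. -/
def UAWTendsto {E : Type*} [NormedAddCommGroup E] [Lattice E] [HasSolidNorm E]
    [IsOrderedAddMonoid E] [NormedSpace ℝ E] {ι : Type*} (x : ι → E) (l : Filter ι) (a : E) :
    Prop :=
  ∀ z : E, 0 ≤ z → Tendsto (fun i => toWeakSpace ℝ E (|x i - a| ⊓ z)) l (𝓝 0)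

/-- `f` is uaw*-convergent to `g` along `l`: `|f i - g| ⊓ h → 0` weak*, for every `h ≥ 0` in the
dual. -/
def UAWStarTendsto {F : Type*} [NormedAddCommGroup F] [Lattice F] [HasSolidNorm F]
    [IsOrderedAddMonoid F] [NormedSpace ℝ F] {ι : Type*} (f : ι → StrongDual ℝ F) (l : Filter ι)
    (g : StrongDual ℝ F) : Prop :=
  ∀ h : StrongDual ℝ F, 0 ≤ h →
    Tendsto (fun i => StrongDual.toWeakDual (|f i - g| ⊓ h)) l (𝓝 0)

/-- `T : E → Y` is `S`-L-weakly compact: `T` maps the uaw-null sequences in the solid hull of `S`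
to norm null sequences. -/
def IsSLWeaklyCompact {E : Type*} [NormedAddCommGroup E] [Lattice E] [HasSolidNorm E]
    [IsOrderedAddMonoid E] [NormedSpace ℝ E] {Y : Type*} [NormedAddCommGroup Y] [NormedSpace ℝ Y]
    (S : Set E) (T : E →L[ℝ] Y) : Prop :=
  ∀ x : ℕ → E, (∀ n, x n ∈ LatticeOrderedAddCommGroup.solidClosure S) →
    UAWTendsto x atTop 0 → Tendsto (fun n => T (x n)) atTop (𝓝 0)

/-! ### Disjoint elements of vector lattices -/

namespace VectorLattice

section Group

variable {G : Type*} [AddCommGroup G] [Lattice G] [IsOrderedAddMonoid G]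

/-! Only 1 → 2 has content: 2 bounds `‖T'f‖` by a weak* test, and uaw-null implies uaw*-null. Write
`A` for the positive cone of the solid hull of `S`. Hahn-Banach turns 1 into two facts about
disjoint sequences, with `‖x n‖ ≤ 1`. For disjoint `f n` in `A`, `f n |T (x n)| → 0`, since the
value is attained at `T (x n)` by some `h n` in `[-f n, f n]`, and these are disjoint, hence
uaw-null (`tendsto_apply_abs_of_disjoint`). For fixed `f` in `A` and disjoint `0 ≤ y n ≤ |T (x n)|`,
`f (y n) → 0`, since the components of `f` on the ideals of the `y n` sum to at most `f`
(`tendsto_apply_of_disjoint_of_le`).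

A disjointification argument (`exists_forall_apply_sub_posPart_le`) makes such limits uniform. In
`F'` it gives `g` with `(|f| - g)⁺ |T x|` small; in `F` it gives `z` with `g (|T x| - z)⁺` small.
Adding these errors to `(|f| ⊓ g) z` bounds `|f| |T x|`, hence `‖T'f‖`. -/

theorem add_inf_le {a b c : G} (ha : 0 ≤ a) (hb : 0 ≤ b) (hc : 0 ≤ c) :
    (a + b) ⊓ c ≤ a ⊓ c + b ⊓ c := by
  rw [inf_add, add_inf, add_inf]
  refine le_inf (le_inf inf_le_left ?_) (le_inf ?_ ?_)
  · exact inf_le_right.trans (le_add_of_nonneg_left ha)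
  · exact inf_le_right.trans (le_add_of_nonneg_right hb)
  · exact inf_le_right.trans (le_add_of_nonneg_right hc)

theorem add_inf_eq_zero {a b c : G} (ha : 0 ≤ a) (hb : 0 ≤ b) (hc : 0 ≤ c) (hac : a ⊓ c = 0)
    (hbc : b ⊓ c = 0) : (a + b) ⊓ c = 0 := by
  refine le_antisymm ((add_inf_le ha hb hc).trans ?_) (le_inf (add_nonneg ha hb) hc)
  rw [hac, hbc, add_zero]

theorem nsmul_inf_eq_zero {a c : G} (ha : 0 ≤ a) (hc : 0 ≤ c) (hac : a ⊓ c = 0) (k : ℕ) :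
    (k • a) ⊓ c = 0 := by
  induction k with
  | zero => simpa using hc
  | succ k ih =>
    rw [succ_nsmul]
    exact add_inf_eq_zero (nsmul_nonneg ha k) ha hc ih hac

theorem inf_eq_zero_of_le {a b c d : G} (ha : 0 ≤ a) (hb : 0 ≤ b) (hac : a ≤ c) (hbd : b ≤ d)
    (h : c ⊓ d = 0) : a ⊓ b = 0 :=
  le_antisymm ((inf_le_inf hac hbd).trans h.le) (le_inf ha hb)

/-- Disjointness passes to the principal ideals generated by the two elements. -/
theorem inf_eq_zero_of_le_nsmul {a b c d : G} (ha : 0 ≤ a) (hb : 0 ≤ b) (hc : 0 ≤ c) (hd : 0 ≤ d)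
    {k l : ℕ} (hac : a ≤ k • c) (hbd : b ≤ l • d) (h : c ⊓ d = 0) : a ⊓ b = 0 := by
  refine inf_eq_zero_of_le ha hb hac hbd ?_
  rw [inf_comm]
  refine nsmul_inf_eq_zero hd (nsmul_nonneg hc k) ?_ l
  rw [inf_comm]
  exact nsmul_inf_eq_zero hc hd h k

/-- A sum of disjoint positive elements is their supremum, because `a + b = a ⊓ b + a ⊔ b`. -/
theorem sum_le_of_pairwise_disjoint {w : ℕ → G} {x : G} (hx : 0 ≤ x) (h0 : ∀ n, 0 ≤ w n)
    (hw : Pairwise fun i j => w i ⊓ w j = 0) (hwx : ∀ n, w n ≤ x) (n : ℕ) :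
    ∑ i ∈ Finset.range n, w i ≤ x := by
  have key : ∀ n m, n ≤ m → (∑ i ∈ Finset.range n, w i) ⊓ w m = 0 := by
    intro n
    induction n with
    | zero => intro m _; simpa using h0 m
    | succ n ih =>
      intro m hm
      rw [Finset.sum_range_succ]
      exact add_inf_eq_zero (Finset.sum_nonneg fun i _ => h0 i) (h0 n) (h0 m) (ih m (by omega))
        (hw (by omega))
  induction n with
  | zero => simpa using hx
  | succ n ih =>
    rw [Finset.sum_range_succ, ← inf_add_sup, key n n le_rfl, zero_add]
    exact sup_le ih (hwx n)

theorem sub_posPart_inf_sub_posPart {a b : G} :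
    (a - b)⁺ ⊓ (b - a)⁺ = 0 := by
  rw [← neg_sub a b, posPart_neg]
  exact posPart_inf_negPart_eq_zero _

theorem add_posPart_le (a b : G) : (a + b)⁺ ≤ a⁺ + b⁺ :=
  sup_le (add_le_add (le_posPart a) (le_posPart b))
    (add_nonneg (posPart_nonneg a) (posPart_nonneg b))

end Group

section Module

variable {E : Type*} [AddCommGroup E] [Lattice E] [IsOrderedAddMonoid E] [Module ℝ E]
  [IsOrderedModule ℝ E]

theorem abs_smul_of_pos {c : ℝ} (hc : 0 < c) (x : E) : |c • x| = c • |x| := by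
  have key : ∀ {c : ℝ}, 0 < c → ∀ x : E, |c • x| ≤ c • |x| := fun hc x =>
    abs_le'.2 ⟨smul_le_smul_of_nonneg_left (le_abs_self x) hc.le, by
      rw [← smul_neg]; exact smul_le_smul_of_nonneg_left (neg_le_abs x) hc.le⟩
  refine le_antisymm (key hc x) ?_
  have := smul_le_smul_of_nonneg_left (key (inv_pos.2 hc) (c • x)) hc.le
  rwa [smul_smul, smul_smul, inv_mul_cancel₀ hc.ne', mul_inv_cancel₀ hc.ne', one_smul,
    one_smul] at this

theorem exists_le_nsmul {y : E} (hy : 0 ≤ y) {k : ℕ} {z : E} (hz : z ≤ k • y) {c : ℝ} (hc : 0 ≤ c) :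
    ∃ l : ℕ, c • z ≤ l • y := by
  obtain ⟨l, hl⟩ := exists_nat_ge (c * k)
  refine ⟨l, (smul_le_smul_of_nonneg_left hz hc).trans ?_⟩
  rw [← Nat.cast_smul_eq_nsmul ℝ k, ← Nat.cast_smul_eq_nsmul ℝ l, smul_smul]
  exact smul_le_smul_of_nonneg_right hl hy

/-- If `1 ≤ c` then `(a - c b)⁺` and `(b - c⁻¹ a)⁺` are disjoint. -/
theorem sub_smul_posPart_disjoint (a b : E) {c : ℝ} (hc : 1 ≤ c) :
    (a - c • b)⁺ ⊓ (b - c⁻¹ • a)⁺ = 0 := by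
  have h0 : 0 < c := by linarith
  refine inf_eq_zero_of_le (posPart_nonneg _) (posPart_nonneg _) le_rfl ?_
    (sub_posPart_inf_sub_posPart (a := a) (b := c • b))
  refine sup_le ?_ (posPart_nonneg _)
  -- Since `c⁻¹ ≤ 1`, this rescaling only shrinks `(c • b - a)⁺`, which is disjoint from `(a - c •
  -- b)⁺`.
  have h1 : b - c⁻¹ • a = c⁻¹ • (c • b - a) := by
    rw [smul_sub, smul_smul, inv_mul_cancel₀ h0.ne', one_smul]
  rw [h1]
  refine (smul_le_smul_of_nonneg_left (le_posPart _) (inv_pos.2 h0).le).trans ?_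
  have := smul_le_smul_of_nonneg_right (inv_le_one_of_one_le₀ hc) (posPart_nonneg (c • b - a))
  rwa [one_smul] at this

end Module

end VectorLattice

/-! ### Hahn-Banach in the dual lattice and components on principal ideals -/

namespace DualLattice

open VectorLattice

variable {F : Type*} [NormedAddCommGroup F] [Lattice F] [HasSolidNorm F] [IsOrderedAddMonoid F]
  [NormedSpace ℝ F]

instance instIsOrderedModule : IsOrderedModule ℝ (StrongDual ℝ F) where
  smul_le_smul_of_nonneg_left c hc f g h x hx := by
    simpa using mul_le_mul_of_nonneg_left (h x hx) hc
  smul_le_smul_of_nonneg_right f hf c d h x hx := by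
    have := hf x hx
    simp only [_root_.zero_apply] at this
    simpa using mul_le_mul_of_nonneg_right h this

theorem apply_mono {f : StrongDual ℝ F} (hf : 0 ≤ f) {x y : F} (h : x ≤ y) : f x ≤ f y := by
  have := hf (y - x) (sub_nonneg.2 h)
  rw [map_sub] at this
  simpa using this

theorem apply_nonneg {f : StrongDual ℝ F} (hf : 0 ≤ f) {x : F} (hx : 0 ≤ x) : 0 ≤ f x := by
  simpa using apply_mono hf hx

/-- Uses `|h| = (2h)⁺ - h` and the map `y ↦ 2y - x` from `[0, x]` into `[-x, x]`. -/
theorem abs_apply_le_of_forall {h : StrongDual ℝ F} {x : F} (hx : 0 ≤ x) {c : ℝ}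
    (hc : ∀ y : F, |y| ≤ x → h y ≤ c) : |h| x ≤ c := by
  have h0 : |h| = dualPosPart (h - -h) - h := by
    change -h + dualPosPart (h - -h) = _
    abel
  rw [h0, _root_.sub_apply, dualPosPart_apply _ hx, sub_le_iff_le_add]
  refine coneSup_le _ hx fun y hy => ?_
  have h1 : |(y + y - x : F)| ≤ x := by
    refine abs_le'.2 ⟨?_, ?_⟩
    · rw [sub_le_iff_le_add]; exact add_le_add hy.2 hy.2
    · rw [neg_sub]; exact sub_le_self _ (add_nonneg hy.1 hy.1)
  have h2 := hc _ h1
  rw [map_sub, map_add] at h2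
  simp only [_root_.sub_apply, _root_.neg_apply]
  linarith

/-- Hahn-Banach for an even sublinear functional which is bounded by a multiple of the norm. -/
theorem exists_eq_and_le_sublinear (p : F → ℝ) (hsmul : ∀ c : ℝ, 0 < c → ∀ x, p (c • x) = c * p x)
    (hadd : ∀ x y, p (x + y) ≤ p x + p y) (hneg : ∀ x, p (-x) = p x) {C : ℝ}
    (hC : ∀ x, p x ≤ C * ‖x‖) (v : F) :
    ∃ h : StrongDual ℝ F, h v = p v ∧ ∀ x, h x ≤ p x := by
  have p0 : p 0 = 0 := by
    have := hsmul 2 (by norm_num) 0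
    rw [smul_zero] at this
    linarith
  have hnn : ∀ x, 0 ≤ p x := fun x => by
    have := hadd x (-x)
    rw [add_neg_cancel, p0, hneg] at this
    linarith
  -- Evenness gives `0 ≤ p`, so the bound on the line through `v` is trivial for negative `c`.
  have habs : ∀ (c : ℝ), c * p v ≤ p (c • v) := fun c => by
    rcases lt_trichotomy c 0 with hc | rfl | hc
    · exact (mul_nonpos_of_nonpos_of_nonneg hc.le (hnn v)).trans (hnn _)
    · simp [p0]
    · exact (hsmul c hc v).ge
  have H : ∀ c : ℝ, c • v = 0 → (RingHom.id ℝ) c • p v = 0 := fun c hc => by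
    rcases smul_eq_zero.1 hc with rfl | rfl
    · simp
    · simp [p0]
  obtain ⟨g, hg1, hg2⟩ := exists_extension_of_le_sublinear
    (LinearPMap.mkSpanSingleton' (σ := RingHom.id ℝ) v (p v) H) p hsmul hadd (by
      rintro ⟨x, hx⟩
      obtain ⟨c, rfl⟩ := Submodule.mem_span_singleton.1 hx
      rw [LinearPMap.mkSpanSingleton'_apply]
      exact habs c)
  refine ⟨g.mkContinuous C fun x => ?_, ?_, fun x => hg2 x⟩
  · rw [Real.norm_eq_abs]
    refine abs_le'.2 ⟨(hg2 x).trans (hC x), ?_⟩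
    rw [← map_neg]
    exact (hg2 _).trans ((hneg x).le.trans (hC x))
  · exact (hg1 ⟨v, Submodule.mem_span_singleton_self v⟩).trans
      (LinearPMap.mkSpanSingleton'_apply_self v (p v) H _)

theorem apply_abs_le_norm {f : StrongDual ℝ F} (x : F) : f |x| ≤ ‖f‖ * ‖x‖ := by
  have := (le_abs_self _).trans (f.le_opNorm |x|)
  rwa [norm_abs_eq_norm] at this

variable [IsOrderedModule ℝ F]

/-- For `f ≥ 0`, the value `f |v|` is attained by some functional in `[-f, f]` at `v`. -/
theorem exists_abs_le_apply_eq {f : StrongDual ℝ F} (hf : 0 ≤ f) (v : F) :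
    ∃ h : StrongDual ℝ F, |h| ≤ f ∧ h v = f |v| := by
  obtain ⟨h, h1, h2⟩ := exists_eq_and_le_sublinear (fun x => f |x|)
    (fun c hc x => by rw [abs_smul_of_pos hc, map_smul, smul_eq_mul])
    (fun x y => by rw [← map_add]; exact apply_mono hf (abs_add_le x y))
    (fun x => by rw [abs_neg]) (fun x => apply_abs_le_norm x) v
  exact ⟨h, fun x hx => abs_apply_le_of_forall hx fun y hy => (h2 y).trans (apply_mono hf hy), h1⟩

/-- The set of `0 ≤ z ≤ |x|` in the ideal generated by `y`. -/
def idealIcc (y x : F) : Set F := {z | 0 ≤ z ∧ z ≤ |x| ∧ ∃ k : ℕ, z ≤ k • y}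

/-- The value at `|x|` of the component of `f` on the ideal generated by `y`. -/
noncomputable def component (f : StrongDual ℝ F) (y x : F) : ℝ := sSup (f '' idealIcc y x)

theorem zero_mem_idealIcc (y x : F) : (0 : F) ∈ idealIcc y x :=
  ⟨le_rfl, abs_nonneg x, 0, by simp⟩

theorem le_component {f : StrongDual ℝ F} (hf : 0 ≤ f) {y x z : F} (hz : z ∈ idealIcc y x) :
    f z ≤ component f y x :=
  le_csSup ⟨f |x|, by rintro _ ⟨z, hz, rfl⟩; exact apply_mono hf hz.2.1⟩ ⟨z, hz, rfl⟩

theorem component_le {f : StrongDual ℝ F} {y x : F} {c : ℝ} (h : ∀ z ∈ idealIcc y x, f z ≤ c) :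
    component f y x ≤ c :=
  csSup_le ⟨f 0, 0, zero_mem_idealIcc y x, rfl⟩ (by rintro _ ⟨z, hz, rfl⟩; exact h z hz)

theorem exists_lt_apply_of_lt_component {f : StrongDual ℝ F} {y x : F} {c : ℝ}
    (h : c < component f y x) : ∃ z ∈ idealIcc y x, c < f z := by
  by_contra! H
  exact absurd (component_le H) (not_le.2 h)

theorem component_smul {f : StrongDual ℝ F} (hf : 0 ≤ f) {y : F} (hy : 0 ≤ y) {c : ℝ} (hc : 0 < c)
    (x : F) : component f y (c • x) = c * component f y x := by
  have key : ∀ {c : ℝ}, 0 < c → ∀ x, c * component f y x ≤ component f y (c • x) := by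
    intro c hc x
    rw [← le_div_iff₀' hc]
    refine component_le fun z hz => ?_
    rw [le_div_iff₀' hc, ← smul_eq_mul, ← map_smul]
    obtain ⟨hz0, hzx, k, hk⟩ := hz
    refine le_component hf ⟨smul_nonneg hc.le hz0, ?_, exists_le_nsmul hy hk hc.le⟩
    rw [abs_smul_of_pos hc]
    exact smul_le_smul_of_nonneg_left hzx hc.le
  refine le_antisymm ?_ (key hc x)
  have := key (inv_pos.2 hc) (c • x)
  rw [smul_smul, inv_mul_cancel₀ hc.ne', one_smul] at this
  rwa [inv_mul_le_iff₀ hc] at this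

/-- Riesz decomposition of `z` along `|a|`; both pieces stay below the same multiple of `y`, so they
remain in the ideal. -/
theorem component_add_le {f : StrongDual ℝ F} (hf : 0 ≤ f) (y a b : F) :
    component f y (a + b) ≤ component f y a + component f y b := by
  refine component_le fun z hz => ?_
  obtain ⟨hz0, hz1, k, hk⟩ := hz
  have h1 : z ⊓ |a| ∈ idealIcc y a :=
    ⟨le_inf hz0 (abs_nonneg a), inf_le_right, k, inf_le_left.trans hk⟩
  have h2 : z - z ⊓ |a| ∈ idealIcc y b := by
    refine ⟨sub_nonneg.2 inf_le_left, ?_, k, ?_⟩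
    · rw [sub_le_comm]
      exact le_inf (sub_le_self _ (abs_nonneg b))
        (sub_le_iff_le_add.2 (hz1.trans (abs_add_le a b)))
    · exact (sub_le_self _ (le_inf hz0 (abs_nonneg a))).trans hk
  have h3 : f z = f (z ⊓ |a|) + f (z - z ⊓ |a|) := by rw [← map_add]; congr 1; abel
  rw [h3]
  exact add_le_add (le_component hf h1) (le_component hf h2)

theorem component_le_norm {f : StrongDual ℝ F} (hf : 0 ≤ f) (y x : F) :
    component f y x ≤ ‖f‖ * ‖x‖ :=
  component_le fun _ hz => (apply_mono hf hz.2.1).trans (apply_abs_le_norm x)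

/-- Near-maximisers for the different components lie in disjoint ideals, so their sum is still at
most `x`. -/
theorem sum_component_le {f : StrongDual ℝ F} (hf : 0 ≤ f) {y : ℕ → F} (hy : ∀ n, 0 ≤ y n)
    (hd : Pairwise fun i j => y i ⊓ y j = 0) {x : F} (hx : 0 ≤ x) (n : ℕ) :
    ∑ i ∈ Finset.range n, component f (y i) x ≤ f x := by
  refine le_of_forall_pos_le_add fun ε hε => ?_
  have hδ : 0 < ε / (n + 1) := by positivity
  choose z hz hfz using fun i =>
    exists_lt_apply_of_lt_component (sub_lt_self (component f (y i) x) hδ)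
  have h1 : ∑ i ∈ Finset.range n, z i ≤ x := by
    refine sum_le_of_pairwise_disjoint hx (fun i => (hz i).1) (fun i j hij => ?_)
      (fun i => ?_) n
    · obtain ⟨k, hk⟩ := (hz i).2.2
      obtain ⟨l, hl⟩ := (hz j).2.2
      exact inf_eq_zero_of_le_nsmul (hz i).1 (hz j).1 (hy i) (hy j) hk hl (hd hij)
    · simpa [abs_of_nonneg hx] using (hz i).2.1
  calc ∑ i ∈ Finset.range n, component f (y i) x
      ≤ ∑ i ∈ Finset.range n, (f (z i) + ε / (n + 1)) :=
        Finset.sum_le_sum fun i _ => by linarith [hfz i]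
    _ = f (∑ i ∈ Finset.range n, z i) + n * (ε / (n + 1)) := by
        rw [Finset.sum_add_distrib, map_sum]; simp
    _ ≤ f x + ε := by
        refine add_le_add (apply_mono hf h1) ?_
        rw [mul_div_assoc', div_le_iff₀ (by positivity)]
        nlinarith

/-- Disjoint elements `y n ≤ |v n|` carry functionals `h n` whose moduli add up to at most `f` and
which dominate `f (y n)` at `v n`. -/
theorem exists_sum_abs_le {f : StrongDual ℝ F} (hf : 0 ≤ f) {y v : ℕ → F} (hy : ∀ n, 0 ≤ y n)
    (hd : Pairwise fun i j => y i ⊓ y j = 0) (hyv : ∀ n, y n ≤ |v n|) :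
    ∃ h : ℕ → StrongDual ℝ F, (∀ n, f (y n) ≤ h n (v n)) ∧
      ∀ n, ∑ i ∈ Finset.range n, |h i| ≤ f := by
  -- The dominating functional is the component itself, which is even because it depends only on the
  -- modulus of its argument.
  choose h h1 h2 using fun n => exists_eq_and_le_sublinear (component f (y n))
    (fun c hc x => component_smul hf (hy n) hc x) (component_add_le hf (y n))
    (fun x => by simp only [component, idealIcc, abs_neg]) (component_le_norm hf (y n)) (v n)
  refine ⟨h, fun n => ?_, fun n x hx => ?_⟩
  · rw [h1]
    exact le_component hf ⟨hy n, hyv n, 1, by simp⟩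
  · refine le_trans ?_ (sum_component_le hf hy hd hx n)
    rw [_root_.sum_apply]
    refine Finset.sum_le_sum fun i _ => abs_apply_le_of_forall hx fun t ht => (h2 i t).trans ?_
    refine component_le fun z hz => le_component hf ⟨hz.1, ?_, hz.2.2⟩
    rw [abs_of_nonneg hx]
    exact hz.2.1.trans ht

end DualLattice

open VectorLattice DualLattice

/-! ### Truncation along disjoint sequences -/

section Truncation

variable {E : Type*} [NormedAddCommGroup E] [Lattice E] [HasSolidNorm E] [IsOrderedAddMonoid E]
  [NormedSpace ℝ E] [IsOrderedModule ℝ E]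

/-- Given a sequence `f` of positive elements with partial sums `s` and an element `u` above all
`2⁻ⁿ f n`, the elements `(f n - 4ⁿ s n - 2⁻ⁿ u)⁺` are pairwise disjoint. -/
theorem pairwise_disjoint_truncation {f : ℕ → E} (hf : ∀ n, 0 ≤ f n) {u : E}
    (hu : ∀ n, (2⁻¹ : ℝ) ^ n • f n ≤ u) :
    Pairwise fun i j =>
      (f i - (4 : ℝ) ^ i • ∑ k ∈ Finset.range i, f k - (2⁻¹ : ℝ) ^ i • u)⁺ ⊓
        (f j - (4 : ℝ) ^ j • ∑ k ∈ Finset.range j, f k - (2⁻¹ : ℝ) ^ j • u)⁺ = 0 := by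
  have hu0 : 0 ≤ u := (smul_nonneg (by positivity) (hf 0)).trans (hu 0)
  have key : ∀ m n, m < n →
      (f n - (4 : ℝ) ^ n • ∑ k ∈ Finset.range n, f k - (2⁻¹ : ℝ) ^ n • u)⁺ ⊓
        (f m - (4 : ℝ) ^ m • ∑ k ∈ Finset.range m, f k - (2⁻¹ : ℝ) ^ m • u)⁺ = 0 := by
    intro m n hmn
    -- Compare with `(f n - 4ⁿ f m)⁺` and `(f m - 4⁻ⁿ f n)⁺`: `f m` is a summand of the `n`-th
    -- partial sum, and `4⁻ⁿ f n ≤ 2⁻ᵐ 2⁻ⁿ f n ≤ 2⁻ᵐ u`.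
    refine inf_eq_zero_of_le (posPart_nonneg _) (posPart_nonneg _) (posPart_mono ?_)
      (posPart_mono ?_) (sub_smul_posPart_disjoint (f n) (f m) (one_le_pow₀ (n := n)
        (by norm_num : (1 : ℝ) ≤ 4)))
    · refine (sub_le_self _ (smul_nonneg (by positivity) hu0)).trans (sub_le_sub_left ?_ _)
      exact smul_le_smul_of_nonneg_left
        (Finset.single_le_sum (fun i _ => hf i) (Finset.mem_range.2 hmn)) (by positivity)
    · refine (sub_le_sub_right (sub_le_self _ (smul_nonneg (by positivity)
        (Finset.sum_nonneg fun i _ => hf i))) _).trans (sub_le_sub_left ?_ _)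
      refine le_trans ?_ (smul_le_smul_of_nonneg_left (hu n) (by positivity))
      rw [smul_smul]
      refine smul_le_smul_of_nonneg_right ?_ (hf n)
      rw [← inv_pow, show (4⁻¹ : ℝ) = 2⁻¹ * 2⁻¹ by norm_num, mul_pow]
      exact mul_le_mul_of_nonneg_right
        (pow_le_pow_of_le_one (by norm_num) (by norm_num) hmn.le) (by positivity)
  intro i j hij
  rcases lt_or_gt_of_ne hij with h | h
  · rw [inf_comm]
    exact key i j h
  · exact key j i h

/-- If positive functionals from a bounded set `P` tend to zero along the disjoint sequences of a
bounded set `A` in the positive cone, then they are uniformly small on the elements `(f - g)⁺`,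
`f ∈ A`, for a suitable `g` in the span of `A`. -/
theorem exists_forall_apply_sub_posPart_le [CompleteSpace E] {A : Set E} {P : Set (StrongDual ℝ E)}
    (hA0 : ∀ a ∈ A, 0 ≤ a) (hAle : ∀ a ∈ A, ∀ b, 0 ≤ b → b ≤ a → b ∈ A)
    {C : ℝ} (hAC : ∀ a ∈ A, ‖a‖ ≤ C) (hP0 : ∀ φ ∈ P, 0 ≤ φ) {D : ℝ} (hPD : ∀ φ ∈ P, ‖φ‖ ≤ D)
    (hlim : ∀ (v : ℕ → E) (φ : ℕ → StrongDual ℝ E), (∀ n, v n ∈ A) → (∀ n, φ n ∈ P) →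
      (Pairwise fun i j => v i ⊓ v j = 0) → Tendsto (fun n => φ n (v n)) atTop (𝓝 0))
    {ε : ℝ} (hε : 0 < ε) :
    ∃ g ∈ Submodule.span ℝ A, 0 ≤ g ∧ ∀ f ∈ A, ∀ φ ∈ P, φ (f - g)⁺ ≤ ε := by
  by_contra! H
  choose! a haA φ hφP hlt using H
  -- If no `g` works, each `4ⁿ • s n` fails; its witness is the next summand of `s`.
  let s : ℕ → E := fun n => Nat.rec 0 (fun n t => t + a ((4 : ℝ) ^ n • t)) n
  have hs : ∀ n, s (n + 1) = s n + a ((4 : ℝ) ^ n • s n) := fun n => rfl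
  have hgood : ∀ n, s n ∈ Submodule.span ℝ A ∧ 0 ≤ s n := by
    intro n
    induction n with
    | zero => exact ⟨Submodule.zero_mem _, le_rfl⟩
    | succ n ih =>
      have := haA _ (Submodule.smul_mem _ ((4 : ℝ) ^ n) ih.1)
        (smul_nonneg (by positivity) ih.2)
      rw [hs]
      exact ⟨Submodule.add_mem _ ih.1 (Submodule.subset_span this),
        add_nonneg ih.2 (hA0 _ this)⟩
  set f : ℕ → E := fun n => a ((4 : ℝ) ^ n • s n) with hf
  set ψ : ℕ → StrongDual ℝ E := fun n => φ ((4 : ℝ) ^ n • s n) with hψ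
  have hmem : ∀ n, (4 : ℝ) ^ n • s n ∈ Submodule.span ℝ A := fun n =>
    Submodule.smul_mem _ _ (hgood n).1
  have hnn : ∀ n, 0 ≤ (4 : ℝ) ^ n • s n := fun n => smul_nonneg (by positivity) (hgood n).2
  have hfA : ∀ n, f n ∈ A := fun n => haA _ (hmem n) (hnn n)
  have hψP : ∀ n, ψ n ∈ P := fun n => hφP _ (hmem n) (hnn n)
  have hf0 : ∀ n, 0 ≤ f n := fun n => hA0 _ (hfA n)
  have hsum : ∀ n, s n = ∑ k ∈ Finset.range n, f k := by
    intro n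
    induction n with
    | zero => rfl
    | succ n ih => rw [Finset.sum_range_succ, hs, ← ih]
  have hgt : ∀ n, ε < ψ n (f n - (4 : ℝ) ^ n • ∑ k ∈ Finset.range n, f k)⁺ := fun n => by
    rw [← hsum]
    exact hlt _ (hmem n) (hnn n)
  have hsummable : Summable fun n => (2⁻¹ : ℝ) ^ n • f n := by
    refine Summable.of_norm_bounded (g := fun n => (2⁻¹ : ℝ) ^ n * C)
      ((summable_geometric_of_lt_one (by norm_num) (by norm_num)).mul_right C) fun n => ?_
    rw [norm_smul, Real.norm_of_nonneg (by positivity)]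
    exact mul_le_mul_of_nonneg_left (hAC _ (hfA n)) (by positivity)
  set u : E := ∑' n, (2⁻¹ : ℝ) ^ n • f n with hu
  have hle : ∀ n, (2⁻¹ : ℝ) ^ n • f n ≤ u := fun n =>
    hsummable.le_tsum n fun i _ => smul_nonneg (by positivity) (hf0 i)
  have hu0 : 0 ≤ u := (smul_nonneg (by positivity) (hf0 0)).trans (hle 0)
  have hdis := pairwise_disjoint_truncation hf0 hle
  set v : ℕ → E := fun n =>
    (f n - (4 : ℝ) ^ n • ∑ k ∈ Finset.range n, f k - (2⁻¹ : ℝ) ^ n • u)⁺ with hv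
  have hvA : ∀ n, v n ∈ A := fun n => by
    refine hAle _ (hfA n) _ (posPart_nonneg _) (sup_le ?_ (hf0 n))
    refine (sub_le_self _ (smul_nonneg (by positivity) hu0)).trans (sub_le_self _ ?_)
    exact smul_nonneg (by positivity) (Finset.sum_nonneg fun i _ => hf0 i)
  have h1 : Tendsto (fun n => ψ n (v n) + (2⁻¹ : ℝ) ^ n * (D * ‖u‖)) atTop (𝓝 (0 + 0 * (D * ‖u‖))) :=
    (hlim v ψ hvA hψP hdis).add
      ((tendsto_pow_atTop_nhds_zero_of_lt_one (by norm_num) (by norm_num)).mul_const _)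
  rw [zero_mul, add_zero] at h1
  obtain ⟨n, hn⟩ := (h1.eventually_lt_const hε).exists
  -- Restoring the subtracted `2⁻ⁿ u` costs at most `2⁻ⁿ D ‖u‖` under `ψ n`, which contradicts `hgt`
  -- for large `n`.
  have h2 : (f n - (4 : ℝ) ^ n • ∑ k ∈ Finset.range n, f k)⁺ ≤ v n + (2⁻¹ : ℝ) ^ n • u := by
    have := add_posPart_le (f n - (4 : ℝ) ^ n • ∑ k ∈ Finset.range n, f k - (2⁻¹ : ℝ) ^ n • u)
      ((2⁻¹ : ℝ) ^ n • u)
    rwa [sub_add_cancel, posPart_of_nonneg (smul_nonneg (by positivity) hu0)] at this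
  have h3 := apply_mono (hP0 _ (hψP n)) h2
  rw [map_add, map_smul, smul_eq_mul] at h3
  have h4 : ψ n u ≤ D * ‖u‖ := ((le_abs_self _).trans ((ψ n).le_opNorm u)).trans
    (mul_le_mul_of_nonneg_right (hPD _ (hψP n)) (norm_nonneg u))
  have h5 : (2⁻¹ : ℝ) ^ n * ψ n u ≤ (2⁻¹ : ℝ) ^ n * (D * ‖u‖) :=
    mul_le_mul_of_nonneg_left h4 (by positivity)
  linarith [hgt n]

end Truncation

/-! ### Weakly null sequences -/

section Weak

variable {E : Type*} [NormedAddCommGroup E] [Lattice E] [HasSolidNorm E] [IsOrderedAddMonoid E]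
  [NormedSpace ℝ E]

theorem tendsto_toWeakSpace_zero_iff {ι : Type*} {l : Filter ι} {x : ι → E} :
    Tendsto (fun i => toWeakSpace ℝ E (x i)) l (𝓝 0) ↔
      ∀ φ : StrongDual ℝ E, Tendsto (fun i => φ (x i)) l (𝓝 0) := by
  have := WeakBilin.tendsto_iff_forall_eval_tendsto (l := l)
    (f := fun i => toWeakSpace ℝ E (x i)) (x := 0) (B := (topDualPairing ℝ E).flip) (by
      intro x y h
      by_contra hne
      obtain ⟨φ, hφ⟩ := SeparatingDual.exists_separating_of_ne (R := ℝ) hne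
      exact hφ (DFunLike.congr_fun h φ))
  refine this.trans (forall_congr' fun φ => ?_)
  have h0 : (topDualPairing ℝ E).flip 0 φ = 0 := map_zero φ
  change Tendsto _ l (𝓝 ((topDualPairing ℝ E).flip 0 φ)) ↔ _
  rw [h0]
  rfl

theorem tendsto_toWeakDual_zero_iff {ι : Type*} {l : Filter ι} {f : ι → StrongDual ℝ E} :
    Tendsto (fun i => StrongDual.toWeakDual (f i)) l (𝓝 0) ↔
      ∀ x : E, Tendsto (fun i => f i x) l (𝓝 0) :=
  tendsto_iff_forall_eval_tendsto_topDualPairing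

/-- The series of `|φ| (w n)` has partial sums at most `|φ| g`, so its terms tend to zero. -/
theorem tendsto_apply_of_sum_le {w : ℕ → E} (hw : ∀ n, 0 ≤ w n) {g : E}
    (hg : ∀ n, ∑ i ∈ Finset.range n, w i ≤ g) (φ : StrongDual ℝ E) :
    Tendsto (fun n => φ (w n)) atTop (𝓝 0) := by
  have hg0 : 0 ≤ g := by simpa using hg 0
  have h1 : Summable fun n => |φ| (w n) := by
    refine summable_of_sum_range_le (c := |φ| g)
      (fun n => apply_nonneg (abs_nonneg φ) (hw n)) fun n => ?_
    rw [← map_sum]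
    exact apply_mono (abs_nonneg φ) (hg n)
  refine squeeze_zero_norm (fun n => ?_) h1.tendsto_atTop_zero
  have := abs_apply_le φ (w n)
  rwa [abs_of_nonneg (hw n)] at this

/-- The truncations `|x n| ⊓ z` are disjoint and below `z`, so their partial sums are too. -/
theorem uawTendsto_zero_of_disjoint {x : ℕ → E} (hx : Pairwise fun i j => |x i| ⊓ |x j| = 0) :
    UAWTendsto x atTop 0 := by
  intro z hz
  rw [tendsto_toWeakSpace_zero_iff]
  intro φ
  simp only [sub_zero]
  have h0 : ∀ n, 0 ≤ |x n| ⊓ z := fun n => le_inf (abs_nonneg _) hz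
  exact tendsto_apply_of_sum_le h0 (sum_le_of_pairwise_disjoint hz h0
    (fun i j hij => inf_eq_zero_of_le (h0 i) (h0 j) inf_le_left inf_le_left (hx hij))
    fun n => inf_le_right) φ

theorem uawTendsto_zero_of_sum_le {x : ℕ → E} {g : E}
    (hg : ∀ n, ∑ i ∈ Finset.range n, |x i| ≤ g) : UAWTendsto x atTop 0 := by
  intro z hz
  rw [tendsto_toWeakSpace_zero_iff]
  intro φ
  simp only [sub_zero]
  exact tendsto_apply_of_sum_le (fun n => le_inf (abs_nonneg _) hz)
    (fun n => (Finset.sum_le_sum fun i _ => inf_le_left).trans (hg n)) φ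

/-- Weak* convergence tests only the evaluations among the functionals on the dual. -/
theorem UAWTendsto.uawStarTendsto {ι : Type*} {l : Filter ι} {f : ι → StrongDual ℝ E}
    {g : StrongDual ℝ E} (h : UAWTendsto f l g) : UAWStarTendsto f l g := by
  intro k hk
  rw [tendsto_toWeakDual_zero_iff]
  intro x
  exact tendsto_toWeakSpace_zero_iff.1 (h k hk) (NormedSpace.inclusionInDoubleDual ℝ E x)

end Weak

/-! ### Truncation of `S`-L-weakly compact adjoints -/

section Adjoint

open LatticeOrderedAddCommGroup

variable {E : Type*} [NormedAddCommGroup E] [NormedSpace ℝ E]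
  {F : Type*} [NormedAddCommGroup F] [Lattice F] [HasSolidNorm F] [IsOrderedAddMonoid F]
  [NormedSpace ℝ F] [IsOrderedModule ℝ F]

theorem apply_le_norm_precomp (T : E →L[ℝ] F) (f : StrongDual ℝ F) {x : E} (hx : ‖x‖ ≤ 1) :
    f (T x) ≤ ‖(T.precomp ℝ : StrongDual ℝ F →L[ℝ] StrongDual ℝ E) f‖ :=
  (le_abs_self _).trans
    (((T.precomp ℝ : StrongDual ℝ F →L[ℝ] StrongDual ℝ E) f).unit_le_opNorm x hx)

theorem norm_precomp_le_of_forall (T : E →L[ℝ] F) (f : StrongDual ℝ F) {c : ℝ}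
    (h : ∀ x : E, ‖x‖ ≤ 1 → |f| |T x| ≤ c) :
    ‖(T.precomp ℝ : StrongDual ℝ F →L[ℝ] StrongDual ℝ E) f‖ ≤ c := by
  have hc : 0 ≤ c := by simpa using h 0 (by simp)
  refine ContinuousLinearMap.opNorm_le_of_unit_norm hc fun x hx => ?_
  exact (abs_apply_le f (T x)).trans (h x hx.le)

variable {S : Set (StrongDual ℝ F)} {T : E →L[ℝ] F}

theorem tendsto_apply_abs_of_disjoint
    (hT : IsSLWeaklyCompact S (T.precomp ℝ : StrongDual ℝ F →L[ℝ] StrongDual ℝ E))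
    {f : ℕ → StrongDual ℝ F} (hf0 : ∀ n, 0 ≤ f n) (hf : ∀ n, f n ∈ solidClosure S)
    (hd : Pairwise fun i j => f i ⊓ f j = 0) {x : ℕ → E} (hx : ∀ n, ‖x n‖ ≤ 1) :
    Tendsto (fun n => f n |T (x n)|) atTop (𝓝 0) := by
  choose h hle heq using fun n => exists_abs_le_apply_eq (hf0 n) (T (x n))
  have hsol : ∀ n, h n ∈ solidClosure S := fun n =>
    isSolid_solidClosure S (hf n) ((hle n).trans (le_abs_self _))
  have h1 := (hT h hsol (uawTendsto_zero_of_disjoint fun i j hij =>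
    inf_eq_zero_of_le (abs_nonneg _) (abs_nonneg _) (hle i) (hle j) (hd hij))).norm
  rw [norm_zero] at h1
  refine squeeze_zero (fun n => apply_nonneg (hf0 n) (abs_nonneg _)) (fun n => ?_) h1
  rw [← heq]
  exact apply_le_norm_precomp T (h n) (hx n)

theorem tendsto_apply_of_disjoint_of_le
    (hT : IsSLWeaklyCompact S (T.precomp ℝ : StrongDual ℝ F →L[ℝ] StrongDual ℝ E))
    {f : StrongDual ℝ F} (hf0 : 0 ≤ f) (hf : f ∈ solidClosure S) {y : ℕ → F} (hy : ∀ n, 0 ≤ y n)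
    (hd : Pairwise fun i j => y i ⊓ y j = 0) {x : ℕ → E} (hx : ∀ n, ‖x n‖ ≤ 1)
    (hyx : ∀ n, y n ≤ |T (x n)|) :
    Tendsto (fun n => f (y n)) atTop (𝓝 0) := by
  obtain ⟨h, hge, hsum⟩ := exists_sum_abs_le hf0 hy hd hyx
  have hle : ∀ n, |h n| ≤ f := fun n =>
    (Finset.single_le_sum (f := fun i => |h i|) (fun i _ => abs_nonneg (h i))
      (Finset.self_mem_range_succ n)).trans (hsum (n + 1))
  have hsol : ∀ n, h n ∈ solidClosure S := fun n =>
    isSolid_solidClosure S hf ((hle n).trans (le_abs_self _))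
  have h1 := (hT h hsol (uawTendsto_zero_of_sum_le hsum)).norm
  rw [norm_zero] at h1
  exact squeeze_zero (fun n => apply_nonneg hf0 (hy n))
    (fun n => (hge n).trans (apply_le_norm_precomp T (h n) (hx n))) h1

/-- Disjointification in `F'`, tested on evaluations at `|T x|`. Keeping `g` in the span lets limits
known only on the solid hull extend to `g`. -/
theorem exists_forall_apply_abs_sub_posPart_le
    (hT : IsSLWeaklyCompact S (T.precomp ℝ : StrongDual ℝ F →L[ℝ] StrongDual ℝ E))
    (hS : Bornology.IsBounded S) {ε : ℝ} (hε : 0 < ε) :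
    ∃ g ∈ Submodule.span ℝ {f | 0 ≤ f ∧ f ∈ solidClosure S}, 0 ≤ g ∧
      ∀ f, 0 ≤ f → f ∈ solidClosure S → ∀ x : E, ‖x‖ ≤ 1 → (f - g)⁺ |T x| ≤ ε := by
  obtain ⟨C, hC⟩ := hS.exists_norm_le
  obtain ⟨g, hg, hg0, h⟩ := exists_forall_apply_sub_posPart_le
    (A := {f | 0 ≤ f ∧ f ∈ solidClosure S})
    (P := {φ | ∃ x : E, ‖x‖ ≤ 1 ∧ φ = NormedSpace.inclusionInDoubleDual ℝ F |T x|})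
    (C := C) (D := ‖T‖) (fun f hf => hf.1)
    (fun f hf k hk hkf => ⟨hk, isSolid_solidClosure S hf.2 (by
      rwa [abs_of_nonneg hk, abs_of_nonneg hf.1])⟩)
    (by
      rintro f ⟨-, k, hk, hfk⟩
      exact (HasSolidNorm.solid hfk).trans (hC k hk))
    (by
      rintro _ ⟨x, -, rfl⟩ f hf
      exact apply_nonneg hf (abs_nonneg _))
    (by
      rintro _ ⟨x, hx, rfl⟩
      refine (NormedSpace.double_dual_bound ℝ F _).trans ?_
      rw [norm_abs_eq_norm]
      exact T.unit_le_opNorm x hx)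
    (by
      intro v φ hv hφ hd
      choose x hx hφx using hφ
      refine (tendsto_apply_abs_of_disjoint hT (fun n => (hv n).1) (fun n => (hv n).2) hd
        hx).congr fun n => ?_
      rw [hφx]
      rfl)
    hε
  exact ⟨g, hg, hg0, fun f hf hfS x hx => h f ⟨hf, hfS⟩ _ ⟨x, hx, rfl⟩⟩

theorem exists_forall_apply_abs_sub_le [CompleteSpace F]
    (hT : IsSLWeaklyCompact S (T.precomp ℝ : StrongDual ℝ F →L[ℝ] StrongDual ℝ E))
    {g : StrongDual ℝ F} (hg0 : 0 ≤ g)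
    (hg : g ∈ Submodule.span ℝ {f | 0 ≤ f ∧ f ∈ solidClosure S}) {ε : ℝ} (hε : 0 < ε) :
    ∃ z : F, 0 ≤ z ∧ ∀ x : E, ‖x‖ ≤ 1 → g (|T x| - z)⁺ ≤ ε := by
  obtain ⟨z, -, hz0, h⟩ := exists_forall_apply_sub_posPart_le
    (A := {y | 0 ≤ y ∧ ∃ x : E, ‖x‖ ≤ 1 ∧ y ≤ |T x|}) (P := {g}) (C := ‖T‖) (D := ‖g‖)
    (fun y hy => hy.1)
    (fun y ⟨_, x, hx, hyx⟩ k hk hky => ⟨hk, x, hx, hky.trans hyx⟩)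
    (by
      rintro y ⟨hy, x, hx, hyx⟩
      rw [← abs_of_nonneg hy] at hyx
      exact (HasSolidNorm.solid hyx).trans (T.unit_le_opNorm x hx))
    (by rintro _ rfl; exact hg0)
    (by rintro _ rfl; exact le_rfl)
    (by
      intro y φ hy hφ hd
      obtain rfl : φ = fun _ => g := funext hφ
      choose hy0 x hx hyx using hy
      -- The limit is linear in the functional, so it passes to the span; positivity is dropped
      -- because intermediate elements of the span need not be positive.
      clear hφ hg0
      induction hg using Submodule.span_induction with
      | mem f hf => exact tendsto_apply_of_disjoint_of_le hT hf.1 hf.2 hy0 hd hx hyx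
      | zero => simp
      | add f k _ _ hf hk => simpa using hf.add hk
      | smul c f _ hf => simpa using hf.const_mul c)
    hε
  exact ⟨z, hz0, fun x hx => h _ ⟨abs_nonneg _, x, hx, le_rfl⟩ g rfl⟩

theorem IsSLWeaklyCompact.exists_norm_precomp_le [CompleteSpace F]
    (hT : IsSLWeaklyCompact S (T.precomp ℝ : StrongDual ℝ F →L[ℝ] StrongDual ℝ E))
    (hS : Bornology.IsBounded S) {ε : ℝ} (hε : 0 < ε) :
    ∃ g : StrongDual ℝ F, 0 ≤ g ∧ ∃ z : F, 0 ≤ z ∧ ∀ f ∈ solidClosure S,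
      ‖(T.precomp ℝ : StrongDual ℝ F →L[ℝ] StrongDual ℝ E) f‖ ≤ (|f| ⊓ g) z + ε := by
  obtain ⟨g, hg, hg0, hgle⟩ := exists_forall_apply_abs_sub_posPart_le hT hS (half_pos hε)
  obtain ⟨z, hz0, hzle⟩ := exists_forall_apply_abs_sub_le hT hg0 hg (half_pos hε)
  refine ⟨g, hg0, z, hz0, fun f hf => norm_precomp_le_of_forall T f fun x hx => ?_⟩
  have h1 := hgle |f| (abs_nonneg f)
    (isSolid_solidClosure S hf (abs_abs f).le) x hx
  have h2 := hzle x hx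
  -- Split `|f|` at `g` here and `|T x|` at `z` below; each excess costs at most `ε / 2`.
  have h3 : |f| = (|f| - g)⁺ + |f| ⊓ g := by
    rw [inf_eq_sub_posPart_sub]
    abel
  have h4 : (|f| ⊓ g) |T x| ≤ (|f| ⊓ g) z + g (|T x| - z)⁺ := by
    have h0 : 0 ≤ |f| ⊓ g := le_inf (abs_nonneg f) hg0
    have h5 : |T x| ≤ z + (|T x| - z)⁺ := by
      rw [← sub_le_iff_le_add']
      exact le_posPart _
    refine (apply_mono h0 h5).trans ?_
    rw [map_add]
    exact add_le_add le_rfl ((inf_le_right : |f| ⊓ g ≤ g) _ (posPart_nonneg _))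
  have h6 : |f| |T x| = (|f| - g)⁺ |T x| + (|f| ⊓ g) |T x| := by
    conv_lhs => rw [h3]
    rfl
  linarith

theorem tendsto_precomp_of_forall_exists_norm_le
    (h : ∀ ε : ℝ, 0 < ε → ∃ g : StrongDual ℝ F, 0 ≤ g ∧ ∃ z : F, 0 ≤ z ∧ ∀ f ∈ solidClosure S,
      ‖(T.precomp ℝ : StrongDual ℝ F →L[ℝ] StrongDual ℝ E) f‖ ≤ (|f| ⊓ g) z + ε)
    {ι : Type*} {l : Filter ι} {f : ι → StrongDual ℝ F} (hf : ∀ i, f i ∈ solidClosure S)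
    (hf0 : UAWStarTendsto f l 0) :
    Tendsto (fun i => (T.precomp ℝ : StrongDual ℝ F →L[ℝ] StrongDual ℝ E) (f i)) l (𝓝 0) := by
  rw [NormedAddGroup.tendsto_nhds_zero]
  intro ε hε
  obtain ⟨g, hg0, z, -, hle⟩ := h (ε / 2) (half_pos hε)
  have h1 := tendsto_toWeakDual_zero_iff.1 (hf0 g hg0) z
  filter_upwards [h1.eventually_lt_const (half_pos hε)] with i hi
  rw [sub_zero] at hi
  linarith [hle (f i) (hf i)]

end Adjoint

theorem theorem3p6
    {E : Type u} [NormedAddCommGroup E] [Lattice E] [HasSolidNorm E] [IsOrderedAddMonoid E]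
    [NormedSpace ℝ E] [IsOrderedModule ℝ E] [CompleteSpace E]
    {F : Type v} [NormedAddCommGroup F] [Lattice F] [HasSolidNorm F] [IsOrderedAddMonoid F]
    [NormedSpace ℝ F] [IsOrderedModule ℝ F] [CompleteSpace F]
    (T : E →L[ℝ] F) (S : Set (StrongDual ℝ F)) (hS : Bornology.IsBounded S) :
    [IsSLWeaklyCompact S (T.precomp ℝ : StrongDual ℝ F →L[ℝ] StrongDual ℝ E),
     ∀ ε : ℝ, 0 < ε → ∃ g : StrongDual ℝ F, 0 ≤ g ∧ ∃ z : F, 0 ≤ z ∧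
       ∀ f ∈ LatticeOrderedAddCommGroup.solidClosure S,
         ‖(T.precomp ℝ : StrongDual ℝ F →L[ℝ] StrongDual ℝ E) f‖ ≤ (|f| ⊓ g) z + ε,
     ∀ (ι : Type w) [Preorder ι] [IsDirectedOrder ι] [Nonempty ι] (f : ι → StrongDual ℝ F),
       (∀ i, f i ∈ LatticeOrderedAddCommGroup.solidClosure S) → UAWStarTendsto f atTop 0 →
         Tendsto (fun i => (T.precomp ℝ : StrongDual ℝ F →L[ℝ] StrongDual ℝ E) (f i))
           atTop (𝓝 0),
     ∀ f : ℕ → StrongDual ℝ F,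
       (∀ n, f n ∈ LatticeOrderedAddCommGroup.solidClosure S) → UAWStarTendsto f atTop 0 →
         Tendsto (fun n => (T.precomp ℝ : StrongDual ℝ F →L[ℝ] StrongDual ℝ E) (f n))
           atTop (𝓝 0)].TFAE := by
  tfae_have 1 → 2 := fun h ε hε => h.exists_norm_precomp_le hS hε
  tfae_have 2 → 3 := fun h ι _ _ _ f hf hf0 => tendsto_precomp_of_forall_exists_norm_le h hf hf0
  tfae_have 3 → 4 := fun h f hf hf0 => by
    -- Index types of nets live in universe `w`, so a sequence becomes a net over a lifted copy of
    -- `ℕ`.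
    have hdown : Tendsto (ULift.down : ULift.{w} ℕ → ℕ) atTop atTop :=
      tendsto_atTop.2 fun n => (eventually_ge_atTop (ULift.up n)).mono fun _ hi => hi
    have hup : Tendsto (ULift.up : ℕ → ULift.{w} ℕ) atTop atTop :=
      tendsto_atTop.2 fun n => (eventually_ge_atTop n.down).mono fun _ hi => hi
    have : IsDirectedOrder (ULift.{w} ℕ) :=
      ⟨fun a b => ⟨⟨max a.down b.down⟩, le_max_left a.down b.down, le_max_right a.down b.down⟩⟩
    exact (h (ULift.{w} ℕ) (fun i => f i.down) (fun i => hf i.down)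
      fun k hk => (hf0 k hk).comp hdown).comp hup
  tfae_have 4 → 1 := fun h f hf hf0 => h f hf hf0.uawStarTendsto
  tfae_finish
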